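/- **Setting.** Let $\mathbb S^{n+1}$ be the space of real symmetric $(n+1)\times(n+1)$ matrices with the inner product $\langle X,Y\rangle=\operatorname{Tr}(XY^\top)$ and the Frobenius norm (products of copies of $\mathbb S^{n+1}$ carry the Euclidean product norm), let $C\in\mathbb S^{n+1}$, let $\mathcal A:\mathbb S^{n+1}\to\mathbb R^q$ be linear, $d\in\mathbb R^q$, and let $\mathcal P\subseteq\mathbb S^{n+1}$ be a polyhedral convex cone with dual cone $\mathcal P^*$. Put $\mathcal M=\{Y\in\mathbb S^{n+1}: \mathcal A(Y)=d,\ Y\succeq 0\}$ and consider $$\text{(P)}\qquad \min\{\langle C,Y\rangle:\ Y-Z=0,\ Y\in\mathcal M,\ Z\in\mathcal P\}.$$ Let $p(Y,Z)=\delta_{\mathcal M}(Y)+\delta_{\mathcal P}(Z)$ with conjugate $p^*$ (the support function of $\mathcal M\times\mathcal P$). The dual problem is $$\text{(D)}\qquad \max_{W,S_1,S_2}\{-p^*(S_1,S_2):\ C+S_1-W=0,\ S_2+W=0\};$$ let $F_D$ be the set of its feasible points (the points with $(S_1,S_2)\in\operatorname{dom}p^*$ that satisfy the two equations) and $\Omega_D\subseteq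 F_D$ the set of its optimal solutions. **Algorithm.** Let $0<\sigma_0\le\sigma_1\le\cdots$ be real, $\hat\epsilon_k\ge 0$ with $\sum_k\hat\epsilon_k<\infty$, and $W^0\in\mathcal P^*$. An infinite sequence $\{(Y^k,Z^k,W^k)\}$ is generated by the augmented Lagrangian method (ALM) under criterion (C2) if for every $k\ge0$: $Y^{k+1}\in\mathcal M$, $Z^{k+1}\in\mathcal P$, $W^{k+1}=W^k-\sigma_k(Y^{k+1}-Z^{k+1})$, and, with $$V^{k+1}=(Y^{k+1}+W^{k+1}-C,\;Z^{k+1}-W^{k+1}),\quad S^{k+1}=\operatorname{Prox}_{p^*}(V^{k+1}),\quad E^{k+1}=(Y^{k+1},Z^{k+1})-\operatorname{Prox}_{p}(V^{k+1}),$$ $$\text{(C2)}\qquad \|E^{k+1}\|\le\frac{\hat\epsilon_k^2/\sigma_k}{1+\|(Y^{k+1},Z^{k+1})\|+\|(W^{k+1},S^{k+1})\|}\,\min\Big\{\frac{1}{\|W^{k+1}-W^k\|/\sigma_k+1/\sigma_k},\,1\Big\}.$$ **Theorem.** Assume that 1. (P) has an optimal solution; 2. $p^*$ is globally Lipschitz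 continuous on $\operatorname{dom}p^*$; 3. $\Omega_D\neq\emptyset$, and Robinson's constraint qualification for (D) holds at some $(\bar W,\bar S_1,\bar S_2)\in\Omega_D$; that is, $0\in\operatorname{int}\{G(\bar\omega)+DG(\bar\omega)(\omega-\bar\omega):\ \omega=(W,S_1,S_2)\in\mathbb S^{n+1}\times\operatorname{dom}p^*\}$, where $\bar\omega=(\bar W,\bar S_1,\bar S_2)$ and $G(W,S_1,S_2)=(C+S_1-W,\;S_2+W)$; 4. there is a constant $\gamma$ such that for all $W\in\mathbb S^{n+1}$ and $(S_1,S_2)\in\operatorname{dom}p^*$, $$\operatorname{dist}\big((W,S_1,S_2),F_D\big)\le\gamma\,(1+\|(W,S_1,S_2)\|)\,\left\|\begin{pmatrix}C+S_1-W\\ S_2+W\end{pmatrix}\right\|.$$ Let $\{(Y^k,Z^k,W^k)\}$ be an infinite sequence generated by the ALM under criterion (C2). Then $\{W^k\}$ converges to a dual optimal solution, i.e. to some $W^*$ with $(W^*,S_1^*,S_2^*)\in\Omega_D$ for some $(S_1^*,S_2^*)$; the sequence $\{(Y^k,Z^k)\}$ is bounded; and each of its accumulation points is an optimal solution of (P).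 -/

import Mathlib

noncomputable section

namespace DNNALM

/-! ### The space of symmetric matrices with the Frobenius inner product -/

/-- The real symmetric matrices of order `N`, as a subspace of all real `N × N` arrays with the
Euclidean inner product of the entries: `⟪X, Y⟫ = ∑ i j, X i j * Y i j = Tr (X Yᵀ)`, so that the
norm is the Frobenius norm. -/
def symmetricMatrices (N : ℕ) : Submodule ℝ (EuclideanSpace ℝ (Fin N × Fin N)) where
  carrier := {X | ∀ i j, X (i, j) = X (j, i)}
  add_mem' := by
    intro X Y hX hY i j
    simp [hX i j, hY i j]
  zero_mem' := by
    intro i j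
    simp
  smul_mem' := by
    intro c X hX i j
    simp [hX i j]

/-- The Euclidean space of symmetric matrices of order `N`. -/
abbrev Sym (N : ℕ) : Type := symmetricMatrices N

/-- The matrix with the entries of `X`. -/
def toMatrix {N : ℕ} (X : Sym N) : Matrix (Fin N) (Fin N) ℝ :=
  Matrix.of fun i j => X.1 (i, j)

/-- The cone of positive semidefinite matrices. -/
def psdCone (N : ℕ) : Set (Sym N) := {X | (toMatrix X).PosSemidef}

/-- Pairs `(Y, Z)` of symmetric matrices, with the Euclidean product norm. -/
abbrev SymPair (N : ℕ) : Type := WithLp 2 (Sym N × Sym N)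

/-- Triples `(W, (S₁, S₂))` of symmetric matrices, with the Euclidean product norm. -/
abbrev SymTriple (N : ℕ) : Type := WithLp 2 (Sym N × SymPair N)

/-- The pair `(Y, Z)`. -/
def pair {N : ℕ} (Y Z : Sym N) : SymPair N := WithLp.toLp 2 (Y, Z)

/-- The triple `(W, S) = (W, S₁, S₂)`. -/
def triple {N : ℕ} (W : Sym N) (S : SymPair N) : SymTriple N := WithLp.toLp 2 (W, S)

/-! ### Convex analysis -/

section ConvexAnalysis

/-- The indicator function `δ_K` of a set: `0` on `K` and `+∞` outside. -/
def indicatorFn {E : Type*} (K : Set E) (x : E) : EReal :=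
  open Classical in if x ∈ K then 0 else ⊤

/-- The effective domain of an extended real valued function. -/
def effDom {E : Type*} (f : E → EReal) : Set E := {x | f x < ⊤}

/-- The convex conjugate `f*(s) = sup_x (⟪s, x⟫ - f x)`. -/
def conjugate {E : Type*} [NormedAddCommGroup E] [InnerProductSpace ℝ E]
    (f : E → EReal) (s : E) : EReal :=
  ⨆ x : E, ((inner ℝ s x : ℝ) : EReal) - f x

/-- `u` minimizes `v ↦ f v + ‖v - x‖² / 2`. -/
def IsProx {E : Type*} [NormedAddCommGroup E] (f : E → EReal) (x u : E) : Prop :=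
  ∀ v : E, f u + ((‖u - x‖ ^ 2 / 2 : ℝ) : EReal) ≤ f v + ((‖v - x‖ ^ 2 / 2 : ℝ) : EReal)

/-- The proximal mapping `Prox_f`. It is only used for closed proper convex functions `f`, where
the minimizer exists and is unique. -/
def prox {E : Type*} [NormedAddCommGroup E] (f : E → EReal) (x : E) : E :=
  Classical.epsilon (IsProx f x)

/-- A polyhedral convex cone: the intersection of finitely many closed half spaces whose
boundaries contain the origin. -/
def IsPolyhedralCone {E : Type*} [NormedAddCommGroup E] [InnerProductSpace ℝ E]
    (P : Set E) : Prop :=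
  ∃ (l : ℕ) (G : Fin l → E), P = {X | ∀ i, 0 ≤ inner ℝ (G i) X}

/-- The dual cone `P* = {W : ⟪W, X⟫ ≥ 0 for all X ∈ P}`. -/
def dualCone {E : Type*} [NormedAddCommGroup E] [InnerProductSpace ℝ E]
    (P : Set E) : Set E :=
  {W | ∀ X ∈ P, 0 ≤ inner ℝ W X}

/-- Robinson's constraint qualification at `x₀` for the constraints `x ∈ Q`, `G x ∈ K`:
`0 ∈ int {G x₀ + DG(x₀)(Q - x₀) - K}`. -/
def RobinsonCQ {E F : Type*} [NormedAddCommGroup E] [NormedSpace ℝ E]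
    [NormedAddCommGroup F] [NormedSpace ℝ F] (G : E → F) (Q : Set E) (K : Set F) (x₀ : E) :
    Prop :=
  (0 : F) ∈ interior {z | ∃ x ∈ Q, ∃ y ∈ K, z = G x₀ + fderiv ℝ G x₀ (x - x₀) - y}

end ConvexAnalysis

/-! ### The problem and its dual -/

/-- The data of the problem
`min {⟪C, Y⟫ : Y - Z = 0, Y ∈ 𝓕 ∩ 𝕊₊, Z ∈ P}` with `𝓕 = {Y : 𝒜 Y = d}`, in symmetric matrices of
order `n + 1`, where `P` is a polyhedral convex cone. -/
structure Problem (n q : ℕ) where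
  /-- the cost matrix -/
  C : Sym (n + 1)
  /-- the linear operator of the affine constraints -/
  A : Sym (n + 1) →ₗ[ℝ] (Fin q → ℝ)
  /-- the right-hand side of the affine constraints -/
  d : Fin q → ℝ
  /-- the polyhedral convex cone -/
  P : Set (Sym (n + 1))
  polyhedral : IsPolyhedralCone P

namespace Problem

variable {n q : ℕ} (D : Problem n q)

/-- `𝓜 = 𝓕 ∩ 𝕊₊`. -/
def M : Set (Sym (n + 1)) := {Y | D.A Y = D.d} ∩ psdCone (n + 1)

/-- `(Y, Z)` is feasible for the primal problem. -/
def IsFeasible (Y Z : Sym (n + 1)) : Prop := Y ∈ D.M ∧ Z ∈ D.P ∧ Y - Z = 0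

/-- `(Y, Z)` is an optimal solution of the primal problem. -/
def IsOptimal (Y Z : Sym (n + 1)) : Prop :=
  D.IsFeasible Y Z ∧ ∀ Y' Z', D.IsFeasible Y' Z' → inner ℝ D.C Y ≤ inner ℝ D.C Y'

/-- `p (Y, Z) = δ_𝓜 Y + δ_P Z`. -/
def p (x : SymPair (n + 1)) : EReal := indicatorFn D.M x.fst + indicatorFn D.P x.snd

/-- The conjugate `p*`, the support function of `𝓜 × P`. -/
def pStar : SymPair (n + 1) → EReal := conjugate D.p

/-- The constraint map `(W, S₁, S₂) ↦ (C + S₁ - W, S₂ + W)` of the dual problem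
`max {-p*(S₁, S₂) : C + S₁ - W = 0, S₂ + W = 0}`. -/
def dualMap (ω : SymTriple (n + 1)) : SymPair (n + 1) :=
  pair (D.C + ω.snd.fst - ω.fst) (ω.snd.snd + ω.fst)

/-- The triples `(W, S₁, S₂)` with `(S₁, S₂) ∈ dom p*`. -/
def dualDomain : Set (SymTriple (n + 1)) := {ω | ω.snd ∈ effDom D.pStar}

/-- The feasible set of the dual problem. -/
def dualFeasible : Set (SymTriple (n + 1)) := {ω | ω ∈ D.dualDomain ∧ D.dualMap ω = 0}

/-- The set `Ω_D` of the optimal solutions of the dual problem. -/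
def dualOptimal : Set (SymTriple (n + 1)) :=
  {ω | ω ∈ D.dualFeasible ∧ ∀ ω' ∈ D.dualFeasible, -D.pStar ω'.snd ≤ -D.pStar ω.snd}

/-- `p*` is globally Lipschitz continuous on its domain. -/
def LipschitzConjugate : Prop :=
  ∃ L : NNReal, LipschitzOnWith L (fun s => (D.pStar s).toReal) (effDom D.pStar)

/-- The dual problem has an optimal solution at which Robinson's constraint qualification
holds. -/
def DualRobinson : Prop :=
  ∃ ω ∈ D.dualOptimal, RobinsonCQ D.dualMap D.dualDomain {0} ω

/-- The dual error bound: the distance of `(W, S₁, S₂)`, `(S₁, S₂) ∈ dom p*`, to the feasible set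
of the dual problem is bounded by a multiple of the residual of the linear constraints. -/
def DualErrorBound : Prop :=
  ∃ γ : ℝ, ∀ ω ∈ D.dualDomain,
    Metric.infDist ω D.dualFeasible ≤ γ * (1 + ‖ω‖) * ‖D.dualMap ω‖

/-! ### The augmented Lagrangian method -/

/-- The multiplier update `W - σ (Y - Z)`. -/
def Wtilde (σ : ℝ) (W Y Z : Sym (n + 1)) : Sym (n + 1) := W - σ • (Y - Z)

/-- The argument `(Y + W̃ - C, Z - W̃)` of the proximal mappings. -/
def proxArg (σ : ℝ) (W Y Z : Sym (n + 1)) : SymPair (n + 1) :=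
  pair (Y + Wtilde σ W Y Z - D.C) (Z - Wtilde σ W Y Z)

/-- `S̃(Y, Z) = Prox_{p*} (Y + W̃ - C, Z - W̃)`. -/
def Stilde (σ : ℝ) (W Y Z : Sym (n + 1)) : SymPair (n + 1) :=
  prox D.pStar (D.proxArg σ W Y Z)

/-- The residual `Ẽ(Y, Z) = (Y, Z) - Prox_p (Y + W̃ - C, Z - W̃)` of the subproblem. -/
def Etilde (σ : ℝ) (W Y Z : Sym (n + 1)) : SymPair (n + 1) :=
  pair Y Z - prox D.p (D.proxArg σ W Y Z)

/-- `(Y, Z, W)` is an infinite sequence generated by the augmented Lagrangian method with the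
penalty parameters `σ` and the practical stopping criterion with the tolerances `ε`. -/
structure IsALMSequence (σ ε : ℕ → ℝ) (Y Z W : ℕ → Sym (n + 1)) : Prop where
  sigma_pos : ∀ k, 0 < σ k
  sigma_mono : Monotone σ
  eps_nonneg : ∀ k, 0 ≤ ε k
  eps_summable : Summable ε
  W_zero : W 0 ∈ dualCone D.P
  Y_mem : ∀ k, Y (k + 1) ∈ D.M
  Z_mem : ∀ k, Z (k + 1) ∈ D.P
  W_succ : ∀ k, W (k + 1) = Wtilde (σ k) (W k) (Y (k + 1)) (Z (k + 1))
  criterion : ∀ k,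
    ‖D.Etilde (σ k) (W k) (Y (k + 1)) (Z (k + 1))‖ ≤
      (ε k ^ 2 / σ k) /
          (1 + ‖pair (Y (k + 1)) (Z (k + 1))‖ +
            ‖triple (W (k + 1)) (D.Stilde (σ k) (W k) (Y (k + 1)) (Z (k + 1)))‖) *
        min (1 / (‖W (k + 1) - W k‖ / σ k + 1 / σ k)) 1

end Problem

end DNNALM

end

namespace DNNALM

/-! The dual equations force `(S₁, S₂) = (W - C, -W)`, so the dual maximizes a function `θ(W)`, the
infimum over `𝓜 × P` of the Lagrangian `ℓ(Y, Z, W) = ⟪C, Y⟫ - ⟪W, Y - Z⟫`.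

By Moreau's decomposition (`prox_conjugate_indicatorFn_eq`) the subproblem residual `E` is exactly
the residual of the dual equations at `(W^{k+1}, S^{k+1})`. The error bound therefore gives a dual
feasible `V^k` within a multiple of `ε_k² / σ_k` of `W^{k+1}`, and Lipschitz continuity of `p*`
gives `ℓ(Y^{k+1}, Z^{k+1}, W^{k+1}) ≤ θ(V^k) + κ ε_k² / σ_k` (`exists_dualFeasible_near`).

Comparing this with `θ(W*) ≤ ℓ(Y^{k+1}, Z^{k+1}, W*)` for a dual optimal `W*` makes the multipliers
quasi-Fejér monotone (`IsALMSequence.fejer`). Hence they are bounded, their steps vanish, and `Y^k -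
Z^k → 0`. The same inequalities, passed to the limit, show that a cluster point of the multipliers
is dual optimal; quasi-Fejér monotonicity about that point gives convergence of the whole sequence.

Robinson's condition bounds `⟪u, (Y^k, Z^k)⟫` from above for every small `u`, hence bounds the
primal iterates (`RobinsonCQ.isBounded_range`). Their objective is at most `max θ` in the limit, so
weak duality makes every cluster point optimal. -/

theorem indicatorFn_of_mem {X : Type*} {K : Set X} {x : X} (h : x ∈ K) : indicatorFn K x = 0 := by
  simp [indicatorFn, h]

theorem indicatorFn_of_notMem {X : Type*} {K : Set X} {x : X} (h : x ∉ K) : indicatorFn K x = ⊤ := by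
  simp [indicatorFn, h]

/-! ### Support functions, projections and proximal maps -/

section SupportFunction

variable {E : Type*} [NormedAddCommGroup E] [InnerProductSpace ℝ E] {K : Set E}

theorem inner_le_conjugate_indicatorFn {x : E} (hx : x ∈ K) (s : E) :
    ((inner ℝ s x : ℝ) : EReal) ≤ conjugate (indicatorFn K) s := by
  have h := le_iSup (fun x : E => ((inner ℝ s x : ℝ) : EReal) - indicatorFn K x) x
  refine le_trans ?_ h
  simp [indicatorFn_of_mem hx]

theorem conjugate_indicatorFn_le {s : E} {c : ℝ} (h : ∀ x ∈ K, inner ℝ s x ≤ c) :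
    conjugate (indicatorFn K) s ≤ c := by
  refine iSup_le fun x => ?_
  by_cases hx : x ∈ K
  · simpa [indicatorFn_of_mem hx] using h x hx
  · simp [indicatorFn_of_notMem hx]

theorem coe_toReal_conjugate_indicatorFn (hne : K.Nonempty) {s : E}
    (hs : s ∈ effDom (conjugate (indicatorFn K))) :
    (((conjugate (indicatorFn K) s).toReal : ℝ) : EReal) = conjugate (indicatorFn K) s := by
  obtain ⟨x, hx⟩ := hne
  refine EReal.coe_toReal (ne_of_lt hs) fun h => ?_
  have := inner_le_conjugate_indicatorFn hx s
  rw [h] at this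
  simp at this

theorem inner_le_toReal_conjugate_indicatorFn {x : E} (hx : x ∈ K) {s : E}
    (hs : s ∈ effDom (conjugate (indicatorFn K))) :
    inner ℝ s x ≤ (conjugate (indicatorFn K) s).toReal := by
  have := inner_le_conjugate_indicatorFn hx s
  rw [← coe_toReal_conjugate_indicatorFn ⟨x, hx⟩ hs] at this
  exact_mod_cast this

/-- The variational inequality of the projection identifies `Prox` of the indicator function. -/
theorem prox_indicatorFn_eq {v u : E} (hu : u ∈ K) (h : ∀ x ∈ K, inner ℝ (v - u) (x - u) ≤ 0) :
    prox (indicatorFn K) v = u := by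
  have key : ∀ x ∈ K, ‖u - v‖ ^ 2 + ‖x - u‖ ^ 2 ≤ ‖x - v‖ ^ 2 := by
    intro x hx
    have e : x - v = (x - u) - (v - u) := by abel
    rw [e, norm_sub_sq_real (x - u) (v - u), norm_sub_rev u v, real_inner_comm]
    linarith [h x hx]
  have hP : IsProx (indicatorFn K) v u := by
    intro x
    by_cases hx : x ∈ K
    · rw [indicatorFn_of_mem hx, indicatorFn_of_mem hu, zero_add, zero_add, EReal.coe_le_coe_iff]
      nlinarith [key x hx, sq_nonneg ‖x - u‖]
    · rw [indicatorFn_of_notMem hx, EReal.top_add_coe]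
      exact le_top
  -- `epsilon` returns some minimizer because one exists; the quadratic growth in `key` then forces
  -- it to be `u`.
  have hQ : IsProx (indicatorFn K) v (prox (indicatorFn K) v) := Classical.epsilon_spec ⟨u, hP⟩
  set w := prox (indicatorFn K) v
  have hw := hQ u
  by_cases hwK : w ∈ K
  · rw [indicatorFn_of_mem hwK, indicatorFn_of_mem hu, zero_add, zero_add,
      EReal.coe_le_coe_iff] at hw
    have := key w hwK
    have h0 : ‖w - u‖ ^ 2 ≤ 0 := by linarith
    exact sub_eq_zero.1 (norm_eq_zero.1 (pow_eq_zero_iff two_ne_zero |>.1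
      (le_antisymm h0 (sq_nonneg _))))
  · rw [indicatorFn_of_notMem hwK, indicatorFn_of_mem hu, zero_add, EReal.top_add_coe] at hw
    exact absurd (top_le_iff.1 hw) (EReal.coe_ne_top _)

/-- The support function at a normal vector. -/
theorem conjugate_indicatorFn_eq_of_normal {s u : E} (hu : u ∈ K)
    (h : ∀ x ∈ K, inner ℝ s (x - u) ≤ 0) :
    conjugate (indicatorFn K) s = ((inner ℝ s u : ℝ) : EReal) := by
  refine le_antisymm (conjugate_indicatorFn_le fun x hx => ?_)
    (inner_le_conjugate_indicatorFn hu s)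
  have := h x hx
  rw [inner_sub_right] at this
  linarith

/-- Moreau's decomposition for the indicator function and the support function. -/
theorem prox_conjugate_indicatorFn_eq {v u : E} (hu : u ∈ K)
    (h : ∀ x ∈ K, inner ℝ (v - u) (x - u) ≤ 0) :
    prox (conjugate (indicatorFn K)) v = v - u := by
  set f := conjugate (indicatorFn K) with hf
  have h1 : f (v - u) = ((inner ℝ (v - u) u : ℝ) : EReal) :=
    conjugate_indicatorFn_eq_of_normal hu h
  -- The affine minorant `⟪s, u⟫` of `f` touches `f` at `v - u`. Adding the quadratic term gives a
  -- function whose exact expansion about its minimizer `v - u` is this identity.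
  have key : ∀ s : E, inner ℝ (v - u) u + ‖v - u - v‖ ^ 2 / 2 + ‖s - (v - u)‖ ^ 2 / 2 =
      inner ℝ s u + ‖s - v‖ ^ 2 / 2 := by
    intro s
    have e1 : v - u - v = -u := by abel
    have e2 : s - v = (s - (v - u)) - u := by abel
    rw [e2, norm_sub_sq_real (s - (v - u)) u, e1, norm_neg, inner_sub_left s (v - u)]
    ring
  have hle : ∀ s : E, ((inner ℝ s u + ‖s - v‖ ^ 2 / 2 : ℝ) : EReal) ≤
      f s + ((‖s - v‖ ^ 2 / 2 : ℝ) : EReal) := by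
    intro s
    rw [EReal.coe_add]
    exact add_le_add (inner_le_conjugate_indicatorFn hu s) le_rfl
  have hP : IsProx f v (v - u) := by
    intro s
    refine le_trans ?_ (hle s)
    rw [h1, ← EReal.coe_add, EReal.coe_le_coe_iff, ← key s]
    linarith [sq_nonneg ‖s - (v - u)‖]
  have hQ : IsProx f v (prox f v) := Classical.epsilon_spec ⟨_, hP⟩
  set w := prox f v
  have hw := (hle w).trans (hQ (v - u))
  rw [h1, ← EReal.coe_add, EReal.coe_le_coe_iff, ← key w] at hw
  have h0 : ‖w - (v - u)‖ ^ 2 ≤ 0 := by linarith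
  exact sub_eq_zero.1 (norm_eq_zero.1 (pow_eq_zero_iff two_ne_zero |>.1
    (le_antisymm h0 (sq_nonneg _))))

theorem exists_projection [CompleteSpace E] (hne : K.Nonempty) (hcl : IsClosed K)
    (hcv : Convex ℝ K) (v : E) : ∃ u ∈ K, ∀ x ∈ K, inner ℝ (v - u) (x - u) ≤ 0 := by
  obtain ⟨u, hu, h⟩ := exists_norm_eq_iInf_of_complete_convex hne hcl.isComplete hcv v
  exact ⟨u, hu, (norm_eq_iInf_iff_real_inner_le_zero hcv hu).1 h⟩

end SupportFunction

/-! ### Quasi-Fejér sequences -/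

section QuasiFejer

open Filter Topology

/-- A nonnegative sequence that decreases up to summable errors converges. -/
theorem exists_tendsto_of_le_add_summable {a b : ℕ → ℝ} (ha : ∀ k, 0 ≤ a k) (hb : ∀ k, 0 ≤ b k)
    (hs : Summable b) (h : ∀ k, a (k + 1) ≤ a k + b k) : ∃ l, Tendsto a atTop (𝓝 l) := by
  have hanti : Antitone fun k => a k - ∑ i ∈ Finset.range k, b i := by
    refine antitone_nat_of_succ_le fun k => ?_
    rw [Finset.sum_range_succ]
    linarith [h k]
  have hbdd : BddBelow (Set.range fun k => a k - ∑ i ∈ Finset.range k, b i) := by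
    refine ⟨-∑' i, b i, ?_⟩
    rintro _ ⟨k, rfl⟩
    have := hs.sum_le_tsum (Finset.range k) fun i _ => hb i
    dsimp only
    linarith [ha k]
  have h1 := tendsto_atTop_ciInf hanti hbdd
  have h2 := h1.add hs.hasSum.tendsto_sum_nat
  exact ⟨_, h2.congr fun k => by ring⟩

/-- The steps of a quasi-Fejér sequence tend to zero. -/
theorem tendsto_zero_of_add_le {a b c : ℕ → ℝ} (ha : ∀ k, 0 ≤ a k) (hb : ∀ k, 0 ≤ b k)
    (hc : ∀ k, 0 ≤ c k) (hs : Summable b) (h : ∀ k, a (k + 1) + c k ≤ a k + b k) :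
    Tendsto c atTop (𝓝 0) := by
  obtain ⟨l, hl⟩ := exists_tendsto_of_le_add_summable ha hb hs fun k => by linarith [h k, hc k]
  have h1 : Tendsto (fun k => a k - a (k + 1) + b k) atTop (𝓝 (l - l + 0)) :=
    (hl.sub (hl.comp (tendsto_add_atTop_nat 1))).add hs.tendsto_atTop_zero
  rw [sub_self, add_zero] at h1
  exact squeeze_zero hc (fun k => by linarith [h k]) h1

/-- Law of cosines at `y`; applied with `w` a dual solution, `x` the old multiplier and `y` the new
one. -/
theorem norm_sub_sq_add_le {E : Type*} [NormedAddCommGroup E] [InnerProductSpace ℝ E]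
    {w x y : E} {c : ℝ} (h : inner ℝ (w - y) (x - y) ≤ c) :
    ‖w - y‖ ^ 2 + ‖x - y‖ ^ 2 ≤ ‖w - x‖ ^ 2 + 2 * c := by
  have e : w - x = (w - y) - (x - y) := by abel
  rw [e, norm_sub_sq_real (w - y) (x - y)]
  linarith

end QuasiFejer

/-- Using `u` and `-u` makes the one-sided bounds two-sided, scaling extends them from the ball to
the whole space, and the uniform boundedness principle concludes. -/
theorem isBounded_range_of_inner_le {E : Type*} [NormedAddCommGroup E] [InnerProductSpace ℝ E]
    [CompleteSpace E] {x : ℕ → E} {r : ℝ} (hr : 0 < r)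
    (h : ∀ u : E, ‖u‖ < r → ∃ c, ∀ k, inner ℝ u (x k) ≤ c) :
    Bornology.IsBounded (Set.range x) := by
  have hpt : ∀ u : E, ∃ c, ∀ k, ‖innerSL ℝ (x k) u‖ ≤ c := by
    intro u
    -- The `+ 1` keeps the denominator positive at `u = 0` and puts `t • u` strictly inside the
    -- ball.
    set t : ℝ := r / (‖u‖ + 1) with ht
    have htp : 0 < t := by positivity
    have htu : ‖t • u‖ < r := by
      rw [norm_smul, Real.norm_of_nonneg htp.le, ht, div_mul_eq_mul_div,
        div_lt_iff₀ (by positivity)]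
      nlinarith [norm_nonneg u]
    obtain ⟨c, hc⟩ := h (t • u) htu
    obtain ⟨c', hc'⟩ := h (-(t • u)) (by rwa [norm_neg])
    refine ⟨max c c' / t, fun k => ?_⟩
    rw [le_div_iff₀ htp, innerSL_apply_apply, real_inner_comm, Real.norm_eq_abs]
    have h1 := hc k
    have h2 := hc' k
    rw [inner_neg_left] at h2
    rw [real_inner_smul_left] at h1 h2
    have e : |inner ℝ u (x k)| * t = |inner ℝ u (x k) * t| := by rw [abs_mul, abs_of_pos htp]
    rw [e]
    refine abs_le.2 ⟨?_, ?_⟩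
    · linarith [le_max_right c c']
    · linarith [le_max_left c c']
  obtain ⟨c, hc⟩ := banach_steinhaus hpt
  refine (Metric.isBounded_closedBall (x := (0 : E)) (r := c)).subset ?_
  rintro _ ⟨k, rfl⟩
  simpa using hc k

open Filter Topology

/-! ### Closedness and convexity of the constraint sets -/

theorem inner_pair {N : ℕ} (Y Z Y' Z' : Sym N) :
    inner ℝ (pair Y Z) (pair Y' Z') = inner ℝ Y Y' + inner ℝ Z Z' := by
  simp [pair, WithLp.prod_inner_apply]

theorem toMatrix_isHermitian {N : ℕ} (X : Sym N) : (toMatrix X).IsHermitian := by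
  ext i j
  simpa [toMatrix] using X.2 j i

theorem continuous_toMatrix {N : ℕ} : Continuous (toMatrix : Sym N → Matrix (Fin N) (Fin N) ℝ) := by
  refine continuous_pi fun i => continuous_pi fun j => ?_
  change Continuous fun X : Sym N => X.1 (i, j)
  fun_prop

theorem isClosed_psdCone (N : ℕ) : IsClosed (psdCone N) := by
  have e : psdCone N = ⋂ x : Fin N → ℝ, {X : Sym N | 0 ≤ star x ⬝ᵥ ((toMatrix X).mulVec x)} := by
    ext X
    simp only [psdCone, Set.mem_ofPred_eq, Matrix.posSemidef_iff_dotProduct_mulVec,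
      toMatrix_isHermitian, true_and, Set.mem_iInter]
  rw [e]
  refine isClosed_iInter fun x => isClosed_le continuous_const ?_
  exact continuous_const.dotProduct (continuous_toMatrix.matrix_mulVec continuous_const)

theorem convex_psdCone (N : ℕ) : Convex ℝ (psdCone N) := by
  intro X hX Y hY a b ha hb _
  exact (Matrix.PosSemidef.smul hX ha).add (Matrix.PosSemidef.smul hY hb)

theorem IsPolyhedralCone.isClosed {E : Type*} [NormedAddCommGroup E] [InnerProductSpace ℝ E]
    {P : Set E} (hP : IsPolyhedralCone P) : IsClosed P := by
  obtain ⟨l, G, rfl⟩ := hP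
  rw [Set.ofPred_forall]
  exact isClosed_iInter fun i => isClosed_le continuous_const (by fun_prop)

theorem IsPolyhedralCone.convex {E : Type*} [NormedAddCommGroup E] [InnerProductSpace ℝ E]
    {P : Set E} (hP : IsPolyhedralCone P) : Convex ℝ P := by
  obtain ⟨l, G, rfl⟩ := hP
  intro X hX Y hY a b ha hb _ i
  rw [inner_add_right, real_inner_smul_right, real_inner_smul_right]
  exact add_nonneg (mul_nonneg ha (hX i)) (mul_nonneg hb (hY i))

/-! ### The dual problem in the multiplier alone -/

namespace Problem

variable {n q : ℕ} (D : Problem n q)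

theorem isClosed_M : IsClosed D.M :=
  (isClosed_eq D.A.continuous_of_finiteDimensional continuous_const).inter (isClosed_psdCone _)

theorem convex_M : Convex ℝ D.M := by
  refine Convex.inter ?_ (convex_psdCone _)
  exact (convex_singleton D.d).linear_preimage D.A

/-- `𝓜 × P` as a set of pairs. -/
def K : Set (SymPair (n + 1)) := {x | x.fst ∈ D.M ∧ x.snd ∈ D.P}

theorem isClosed_K : IsClosed D.K :=
  (D.isClosed_M.preimage (WithLp.continuous_fst 2 _ _)).inter
    (D.polyhedral.isClosed.preimage (WithLp.continuous_snd 2 _ _))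

theorem convex_K : Convex ℝ D.K := fun _ hx _ hy _ _ ha hb hab =>
  ⟨D.convex_M hx.1 hy.1 ha hb hab, D.polyhedral.convex hx.2 hy.2 ha hb hab⟩

theorem p_eq : D.p = indicatorFn D.K := by
  funext x
  by_cases h1 : x.fst ∈ D.M <;> by_cases h2 : x.snd ∈ D.P <;> simp [p, indicatorFn, K, h1, h2]

theorem pStar_eq : D.pStar = conjugate (indicatorFn D.K) := by rw [pStar, p_eq]

/-- The only `(S₁, S₂)` for which `(W, S₁, S₂)` satisfies the dual equations. -/
noncomputable def slack (W : Sym (n + 1)) : SymPair (n + 1) := pair (W - D.C) (-W)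

/-- The dual objective `-p*(W - C, -W)`, meaningful where it is finite. -/
noncomputable def dualValue (W : Sym (n + 1)) : ℝ := -(D.pStar (D.slack W)).toReal

/-- The right-hand side is minus the Lagrangian, so `p*(W - C, -W)` is minus its infimum over `𝓜 ×
P`. -/
theorem inner_slack (W Y Z : Sym (n + 1)) :
    inner ℝ (D.slack W) (pair Y Z) = -(inner ℝ D.C Y - inner ℝ W (Y - Z)) := by
  rw [slack, inner_pair, inner_sub_left, inner_neg_left, inner_sub_right]
  ring

/-- The residual of the dual equations is the deviation of `S` from the slack of `W`; this is what
identifies it with the residual of the subproblem. -/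
theorem dualMap_triple (W : Sym (n + 1)) (x : SymPair (n + 1)) :
    D.dualMap (triple W (x + D.slack W)) = x := by
  refine (WithLp.ofLp_injective 2) (Prod.ext ?_ ?_)
  · change D.C + (x.fst + (W - D.C)) - W = x.fst
    abel
  · change x.snd + -W + W = x.snd
    abel

theorem mem_dualFeasible_iff {ω : SymTriple (n + 1)} :
    ω ∈ D.dualFeasible ↔ ω.snd ∈ effDom D.pStar ∧ ω.snd = D.slack ω.fst := by
  have e : ω = triple ω.fst ((ω.snd - D.slack ω.fst) + D.slack ω.fst) := by
    rw [sub_add_cancel]; rfl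
  have h : D.dualMap ω = ω.snd - D.slack ω.fst := by
    conv_lhs => rw [e]
    exact D.dualMap_triple _ _
  change ω.snd ∈ effDom D.pStar ∧ D.dualMap ω = 0 ↔ _
  rw [h, sub_eq_zero]

theorem triple_mem_dualFeasible {W : Sym (n + 1)} (h : D.slack W ∈ effDom D.pStar) :
    triple W (D.slack W) ∈ D.dualFeasible := D.mem_dualFeasible_iff.2 ⟨h, rfl⟩

variable {D}

theorem coe_toReal_pStar (hne : D.K.Nonempty) {s : SymPair (n + 1)} (hs : s ∈ effDom D.pStar) :
    (((D.pStar s).toReal : ℝ) : EReal) = D.pStar s := by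
  rw [pStar_eq] at *
  exact coe_toReal_conjugate_indicatorFn hne hs

theorem inner_le_toReal_pStar {x s : SymPair (n + 1)} (hx : x ∈ D.K) (hs : s ∈ effDom D.pStar) :
    inner ℝ s x ≤ (D.pStar s).toReal := by
  rw [pStar_eq] at *
  exact inner_le_toReal_conjugate_indicatorFn hx hs

theorem pair_mem_K {Y Z : Sym (n + 1)} (hY : Y ∈ D.M) (hZ : Z ∈ D.P) : pair Y Z ∈ D.K := ⟨hY, hZ⟩

/-- Weak duality for the Lagrangian. -/
theorem dualValue_le {W Y Z : Sym (n + 1)} (hW : D.slack W ∈ effDom D.pStar) (hY : Y ∈ D.M)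
    (hZ : Z ∈ D.P) : D.dualValue W ≤ inner ℝ D.C Y - inner ℝ W (Y - Z) := by
  have h := inner_le_toReal_pStar (pair_mem_K hY hZ) hW
  rw [inner_slack] at h
  rw [dualValue]
  linarith

/-- A lower bound of the Lagrangian is a lower bound of the dual objective. -/
theorem slack_mem_and_le_dualValue (hne : D.K.Nonempty) {W : Sym (n + 1)} {c : ℝ}
    (h : ∀ Y ∈ D.M, ∀ Z ∈ D.P, c ≤ inner ℝ D.C Y - inner ℝ W (Y - Z)) :
    D.slack W ∈ effDom D.pStar ∧ c ≤ D.dualValue W := by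
  have h1 : D.pStar (D.slack W) ≤ ((-c : ℝ) : EReal) := by
    rw [pStar_eq]
    refine conjugate_indicatorFn_le fun x hx => ?_
    have e : inner ℝ (D.slack W) x = _ := D.inner_slack W x.fst x.snd
    rw [e]
    linarith [h _ hx.1 _ hx.2]
  have h2 : D.slack W ∈ effDom D.pStar := lt_of_le_of_lt h1 (EReal.coe_lt_top _)
  refine ⟨h2, ?_⟩
  rw [← coe_toReal_pStar hne h2, EReal.coe_le_coe_iff] at h1
  rw [dualValue]
  linarith

theorem dualValue_le_of_mem_dualOptimal (hne : D.K.Nonempty) {ω : SymTriple (n + 1)}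
    (hω : ω ∈ D.dualOptimal) {W : Sym (n + 1)} (hW : D.slack W ∈ effDom D.pStar) :
    D.dualValue W ≤ D.dualValue ω.fst := by
  obtain ⟨h1, h2⟩ := D.mem_dualFeasible_iff.1 hω.1
  have h := hω.2 _ (D.triple_mem_dualFeasible hW)
  change -D.pStar (D.slack W) ≤ _ at h
  rw [EReal.neg_le_neg_iff, ← coe_toReal_pStar hne h1, ← coe_toReal_pStar hne hW,
    EReal.coe_le_coe_iff, h2] at h
  rw [dualValue, dualValue]
  linarith

theorem triple_mem_dualOptimal (hne : D.K.Nonempty) {W : Sym (n + 1)}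
    (hW : D.slack W ∈ effDom D.pStar)
    (h : ∀ V, D.slack V ∈ effDom D.pStar → D.dualValue V ≤ D.dualValue W) :
    triple W (D.slack W) ∈ D.dualOptimal := by
  refine ⟨D.triple_mem_dualFeasible hW, fun ω hω => ?_⟩
  obtain ⟨h1, h2⟩ := D.mem_dualFeasible_iff.1 hω
  rw [h2] at h1
  rw [h2]
  change _ ≤ -D.pStar (D.slack W)
  rw [EReal.neg_le_neg_iff, ← coe_toReal_pStar hne h1, ← coe_toReal_pStar hne hW,
    EReal.coe_le_coe_iff]
  have := h _ h1
  rw [dualValue, dualValue] at this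
  linarith

/-- The residual of the subproblem controls the distance to a dual feasible point of almost the
same dual objective as the Lagrangian. -/
theorem exists_dualFeasible_near (hF : D.dualFeasible.Nonempty) {L : NNReal}
    (hL : LipschitzOnWith L (fun s => (D.pStar s).toReal) (effDom D.pStar)) {γ : ℝ} (hγ : 1 ≤ γ)
    (herr : ∀ ω ∈ D.dualDomain,
      Metric.infDist ω D.dualFeasible ≤ γ * (1 + ‖ω‖) * ‖D.dualMap ω‖)
    {σ e : ℝ} {W Y Z : Sym (n + 1)} (hY : Y ∈ D.M) (hZ : Z ∈ D.P)
    (he : ‖D.Etilde σ W Y Z‖ *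
      (1 + ‖pair Y Z‖ + ‖triple (Wtilde σ W Y Z) (D.Stilde σ W Y Z)‖) ≤ e) :
    ∃ V, D.slack V ∈ effDom D.pStar ∧ ‖V - Wtilde σ W Y Z‖ ≤ 2 * γ * e ∧
      inner ℝ D.C Y - inner ℝ (Wtilde σ W Y Z) (Y - Z) ≤ D.dualValue V + (L * (2 * γ) + 1) * e := by
  set W' := Wtilde σ W Y Z with hW'
  set E := D.Etilde σ W Y Z with hE
  set S := D.Stilde σ W Y Z with hS
  set v := D.proxArg σ W Y Z with hv
  have hX := pair_mem_K hY hZ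
  set X := pair Y Z with hXdef
  obtain ⟨u, hu, hvu⟩ := exists_projection ⟨X, hX⟩ D.isClosed_K D.convex_K v
  have hSv : S = v - u := by
    rw [hS, Stilde, pStar_eq]
    exact prox_conjugate_indicatorFn_eq hu hvu
  have hEu : E = X - u := by
    rw [hE, Etilde, p_eq, ← hv, prox_indicatorFn_eq hu hvu]
  have hvX : v = X + D.slack W' := by
    refine (WithLp.ofLp_injective 2) (Prod.ext ?_ ?_)
    · change Y + W' - D.C = Y + (W' - D.C)
      abel
    · change Z - W' = Z + -W'
      abel
  have hSE : S = E + D.slack W' := by rw [hSv, hEu, hvX]; abel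
  -- `S = v - u` is normal to `𝓜 × P` at the projection `u`, so the supremum defining `p*(S)` is
  -- attained there and is finite.
  have hpS : D.pStar S = ((inner ℝ S u : ℝ) : EReal) := by
    rw [pStar_eq, hSv]
    exact conjugate_indicatorFn_eq_of_normal hu hvu
  have hSdom : S ∈ effDom D.pStar := by
    change D.pStar S < ⊤
    rw [hpS]
    exact EReal.coe_lt_top _
  set ω := triple W' S with hω
  have hmap : D.dualMap ω = E := by rw [hω, hSE]; exact D.dualMap_triple _ _
  have hSω : ‖S‖ ≤ ‖ω‖ := WithLp.norm_snd_le _ ω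
  obtain ⟨ω', hω'F, hω'⟩ : ∃ ω' ∈ D.dualFeasible, ‖ω' - ω‖ ≤ 2 * γ * e := by
    have h0 : (1 + ‖ω‖) * ‖E‖ ≤ e := by
      nlinarith [norm_nonneg E, norm_nonneg X, mul_nonneg (norm_nonneg E) (norm_nonneg X)]
    -- A feasible point is extracted from `infDist` through a strict bound. Doubling `γ` provides
    -- strictness when `E ≠ 0`; when `E = 0` the triple `ω` is itself feasible.
    by_cases hE0 : E = 0
    · refine ⟨ω, ⟨hSdom, hmap.trans hE0⟩, ?_⟩
      rw [sub_self, norm_zero]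
      have : 0 ≤ e := le_trans (by positivity) h0
      positivity
    · have hEp : 0 < ‖E‖ := norm_pos_iff.2 hE0
      have h1 : Metric.infDist ω D.dualFeasible < 2 * γ * ((1 + ‖ω‖) * ‖E‖) := by
        have := herr ω hSdom
        rw [hmap] at this
        have hp : 0 < γ * ((1 + ‖ω‖) * ‖E‖) := by positivity
        linarith
      obtain ⟨ω', hω', hd⟩ := (Metric.infDist_lt_iff hF).1 h1
      refine ⟨ω', hω', ?_⟩
      rw [← dist_eq_norm, dist_comm]
      exact hd.le.trans (mul_le_mul_of_nonneg_left h0 (by linarith))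
  obtain ⟨h1, h2⟩ := D.mem_dualFeasible_iff.1 hω'F
  have hfst : ‖ω'.fst - W'‖ ≤ ‖ω' - ω‖ := WithLp.norm_fst_le _ (ω' - ω)
  have hsnd : ‖ω'.snd - S‖ ≤ ‖ω' - ω‖ := WithLp.norm_snd_le _ (ω' - ω)
  refine ⟨ω'.fst, h2 ▸ h1, hfst.trans hω', ?_⟩
  have hLip := hL.dist_le_mul _ h1 _ hSdom
  rw [dist_eq_norm, dist_eq_norm, Real.norm_eq_abs, hpS, EReal.toReal_coe] at hLip
  have hLip' := (le_abs_self _).trans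
    (hLip.trans (mul_le_mul_of_nonneg_left (hsnd.trans hω') L.coe_nonneg))
  -- With slack `S - E` and `X = u + E`, the Lagrangian is `-p*(S)` plus cross terms of size at most
  -- `‖E‖ (‖S‖ + ‖X‖)`, which is what the weight in the stopping criterion controls.
  have hval : inner ℝ D.C Y - inner ℝ W' (Y - Z) = -inner ℝ S u - inner ℝ S E + inner ℝ E X := by
    have h3 := D.inner_slack W' Y Z
    have h4 : D.slack W' = S - E := by rw [hSE]; abel
    have h5 : u = X - E := by rw [hEu]; abel
    rw [h4, inner_sub_left] at h3
    rw [h5, inner_sub_right S]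
    linarith
  have h6 : -inner ℝ S E ≤ ‖S‖ * ‖E‖ := by
    have := abs_real_inner_le_norm S E
    linarith [neg_abs_le (inner ℝ S E)]
  have h7 : inner ℝ E X ≤ ‖E‖ * ‖X‖ := real_inner_le_norm E X
  have h8 : ‖S‖ * ‖E‖ + ‖E‖ * ‖X‖ ≤ e := by
    nlinarith [norm_nonneg E, mul_le_mul_of_nonneg_right hSω (norm_nonneg E)]
  rw [hval, dualValue, ← h2]
  linarith

/-! ### Robinson's constraint qualification and boundedness -/

theorem fderiv_dualMap (ω₀ ω : SymTriple (n + 1)) :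
    D.dualMap ω₀ + fderiv ℝ D.dualMap ω₀ (ω - ω₀) = D.dualMap ω := by
  let T : SymTriple (n + 1) →ₗ[ℝ] SymPair (n + 1) :=
    { toFun := fun ω => pair (ω.snd.fst - ω.fst) (ω.snd.snd + ω.fst)
      map_add' := fun x y => by
        refine (WithLp.ofLp_injective 2) (Prod.ext ?_ ?_)
        · change x.snd.fst + y.snd.fst - (x.fst + y.fst) =
            x.snd.fst - x.fst + (y.snd.fst - y.fst)
          abel
        · change x.snd.snd + y.snd.snd + (x.fst + y.fst) =
            x.snd.snd + x.fst + (y.snd.snd + y.fst)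
          abel
      map_smul' := fun c x => by
        refine (WithLp.ofLp_injective 2) (Prod.ext ?_ ?_)
        · exact (smul_sub c x.snd.fst x.fst).symm
        · exact (smul_add c x.snd.snd x.fst).symm }
  have e : D.dualMap = fun ω => LinearMap.toContinuousLinearMap T ω + pair D.C 0 := by
    funext ω
    refine (WithLp.ofLp_injective 2) (Prod.ext ?_ ?_)
    · change D.C + ω.snd.fst - ω.fst = ω.snd.fst - ω.fst + D.C
      abel
    · exact (add_zero (ω.snd.snd + ω.fst)).symm
  have hd : HasFDerivAt D.dualMap (LinearMap.toContinuousLinearMap T) ω₀ := by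
    rw [e]
    exact (LinearMap.toContinuousLinearMap T).hasFDerivAt.add_const _
  rw [hd.fderiv, map_sub, e]
  dsimp only
  abel

/-- The dual map is affine, so its linearization is exact: Robinson's condition says that every
small `u` is the residual of some triple in the dual domain, whose `S` part is then `u` plus the
slack of `W`. -/
theorem RobinsonCQ.exists_ball {ω₀ : SymTriple (n + 1)}
    (h : RobinsonCQ D.dualMap D.dualDomain {0} ω₀) :
    ∃ r > 0, ∀ u : SymPair (n + 1), ‖u‖ < r → ∃ W, u + D.slack W ∈ effDom D.pStar := by
  obtain ⟨r, hr, hball⟩ := Metric.mem_nhds_iff.1 (mem_interior_iff_mem_nhds.1 h)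
  refine ⟨r, hr, fun u hu => ?_⟩
  obtain ⟨ω, hω, y, rfl, hz⟩ := hball (mem_ball_zero_iff.2 hu)
  rw [fderiv_dualMap, sub_zero] at hz
  refine ⟨ω.fst, ?_⟩
  have e : u + D.slack ω.fst = ω.snd := by
    rw [hz]
    refine (WithLp.ofLp_injective 2) (Prod.ext ?_ ?_)
    · change D.C + ω.snd.fst - ω.fst + (ω.fst - D.C) = ω.snd.fst
      abel
    · change ω.snd.snd + ω.fst + -ω.fst = ω.snd.snd
      abel
  rw [e]
  exact hω

/-- Under Robinson's constraint qualification of the dual problem, points of `𝓜 × P` with bounded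
difference and objective bounded above are bounded. -/
theorem RobinsonCQ.isBounded_range {ω₀ : SymTriple (n + 1)}
    (h : RobinsonCQ D.dualMap D.dualDomain {0} ω₀) {Y Z : ℕ → Sym (n + 1)}
    (hY : ∀ k, Y k ∈ D.M) (hZ : ∀ k, Z k ∈ D.P) {b c : ℝ} (hb : ∀ k, ‖Y k - Z k‖ ≤ b)
    (hc : ∀ k, inner ℝ D.C (Y k) ≤ c) :
    Bornology.IsBounded (Set.range fun k => pair (Y k) (Z k)) := by
  obtain ⟨r, hr, hu⟩ := RobinsonCQ.exists_ball h
  refine isBounded_range_of_inner_le hr fun u hur => ?_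
  obtain ⟨W, hW⟩ := hu u hur
  -- The support function inequality at `u + slack W` reads `⟪u, (Y, Z)⟫ ≤ p*(u + slack W) + ⟪C, Y⟫
  -- - ⟪W, Y - Z⟫`.
  refine ⟨(D.pStar (u + D.slack W)).toReal + c + ‖W‖ * b, fun k => ?_⟩
  have h1 := inner_le_toReal_pStar (pair_mem_K (hY k) (hZ k)) hW
  rw [inner_add_left, inner_slack] at h1
  have h2 : -inner ℝ W (Y k - Z k) ≤ ‖W‖ * b := by
    have := abs_real_inner_le_norm W (Y k - Z k)
    have h3 := mul_le_mul_of_nonneg_left (hb k) (norm_nonneg W)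
    linarith [neg_abs_le (inner ℝ W (Y k - Z k))]
  linarith [hc k]

/-! ### Estimates along the augmented Lagrangian iteration -/

/-- The stopping criterion without its last factor. -/
theorem IsALMSequence.criterion_mul_le {σ ε : ℕ → ℝ} {Y Z W : ℕ → Sym (n + 1)}
    (h : D.IsALMSequence σ ε Y Z W) (k : ℕ) :
    ‖D.Etilde (σ k) (W k) (Y (k + 1)) (Z (k + 1))‖ *
      (1 + ‖pair (Y (k + 1)) (Z (k + 1))‖ + ‖triple (Wtilde (σ k) (W k) (Y (k + 1)) (Z (k + 1)))
        (D.Stilde (σ k) (W k) (Y (k + 1)) (Z (k + 1)))‖) ≤ ε k ^ 2 / σ k := by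
  have h1 := h.criterion k
  rw [h.W_succ k] at h1
  have hσ := h.sigma_pos k
  rw [← le_div_iff₀ (by positivity)]
  exact h1.trans (mul_le_of_le_one_right (by positivity) (min_le_right _ _))

/-- Dual feasible points close to the multipliers, with almost the same objective. -/
theorem IsALMSequence.exists_dualFeasible {σ ε : ℕ → ℝ} {Y Z W : ℕ → Sym (n + 1)}
    (h : D.IsALMSequence σ ε Y Z W) (hF : D.dualFeasible.Nonempty) (hlip : D.LipschitzConjugate)
    (herr : D.DualErrorBound) :
    ∃ κ : ℝ, 0 ≤ κ ∧ ∃ V : ℕ → Sym (n + 1), ∀ k, D.slack (V k) ∈ effDom D.pStar ∧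
      ‖V k - W (k + 1)‖ ≤ κ * (ε k ^ 2 / σ k) ∧
      inner ℝ D.C (Y (k + 1)) - inner ℝ (W (k + 1)) (Y (k + 1) - Z (k + 1)) ≤
        D.dualValue (V k) + κ * (ε k ^ 2 / σ k) := by
  obtain ⟨L, hL⟩ := hlip
  obtain ⟨γ, hγ⟩ := herr
  -- The constant of the error bound may be any real number; enlarging it to at least `1` makes the
  -- products below positive.
  set g := max γ 1 with hg
  have hg1 : 1 ≤ g := le_max_right _ _
  have herr' : ∀ ω ∈ D.dualDomain,
      Metric.infDist ω D.dualFeasible ≤ g * (1 + ‖ω‖) * ‖D.dualMap ω‖ := by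
    intro ω hω
    refine (hγ ω hω).trans ?_
    gcongr
    exact le_max_left _ _
  have hL0 : (0 : ℝ) ≤ L * (2 * g) := mul_nonneg L.coe_nonneg (by linarith)
  choose V hV using fun k => exists_dualFeasible_near hF hL hg1 herr' (h.Y_mem k) (h.Z_mem k)
    (h.criterion_mul_le k)
  -- The sum of the distance constant and the objective constant serves both estimates.
  refine ⟨2 * g + (L * (2 * g) + 1), by linarith, V, fun k => ?_⟩
  obtain ⟨h1, h2, h3⟩ := hV k
  rw [← h.W_succ k] at h2 h3
  have he : 0 ≤ ε k ^ 2 / σ k := div_nonneg (sq_nonneg _) (h.sigma_pos k).le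
  refine ⟨h1, h2.trans ?_, h3.trans ?_⟩
  · exact mul_le_mul_of_nonneg_right (by linarith) he
  · exact add_le_add le_rfl (mul_le_mul_of_nonneg_right (by linarith) he)

/-- Eventually `ε k < 1`, so `ε k ^ 2 ≤ ε k`. -/
theorem IsALMSequence.summable_sq {σ ε : ℕ → ℝ} {Y Z W : ℕ → Sym (n + 1)}
    (h : D.IsALMSequence σ ε Y Z W) : Summable fun k => ε k ^ 2 := by
  refine Summable.of_norm_bounded_eventually_nat h.eps_summable ?_
  have h1 : ∀ᶠ k in atTop, ε k < 1 := h.eps_summable.tendsto_atTop_zero.eventually_lt_const one_pos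
  filter_upwards [h1] with k hk
  rw [Real.norm_of_nonneg (sq_nonneg _)]
  nlinarith [h.eps_nonneg k]

theorem IsALMSequence.tendsto_tolerance {σ ε : ℕ → ℝ} {Y Z W : ℕ → Sym (n + 1)}
    (h : D.IsALMSequence σ ε Y Z W) : Tendsto (fun k => ε k ^ 2 / σ k) atTop (𝓝 0) := by
  have h1 : Tendsto (fun k => ε k ^ 2 / σ 0) atTop (𝓝 (0 / σ 0)) :=
    h.summable_sq.tendsto_atTop_zero.div_const _
  rw [zero_div] at h1
  refine squeeze_zero (fun k => div_nonneg (sq_nonneg _) (h.sigma_pos k).le) (fun k => ?_) h1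
  exact div_le_div_of_nonneg_left (sq_nonneg _) (h.sigma_pos 0) (h.sigma_mono (Nat.zero_le k))

theorem IsALMSequence.sub_eq {σ ε : ℕ → ℝ} {Y Z W : ℕ → Sym (n + 1)}
    (h : D.IsALMSequence σ ε Y Z W) (k : ℕ) :
    W k - W (k + 1) = σ k • (Y (k + 1) - Z (k + 1)) := by
  rw [h.W_succ k, Wtilde]
  abel

/-- The multipliers are quasi-Fejér monotone with respect to the dual optimal solutions. -/
theorem IsALMSequence.fejer {σ ε : ℕ → ℝ} {Y Z W : ℕ → Sym (n + 1)}
    (h : D.IsALMSequence σ ε Y Z W) (hne : D.K.Nonempty) {ω : SymTriple (n + 1)}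
    (hω : ω ∈ D.dualOptimal) {κ : ℝ} {V : Sym (n + 1)} {k : ℕ}
    (hV : D.slack V ∈ effDom D.pStar)
    (hle : inner ℝ D.C (Y (k + 1)) - inner ℝ (W (k + 1)) (Y (k + 1) - Z (k + 1)) ≤
        D.dualValue V + κ * (ε k ^ 2 / σ k)) :
    ‖W (k + 1) - ω.fst‖ ^ 2 + ‖W k - W (k + 1)‖ ^ 2 ≤ ‖W k - ω.fst‖ ^ 2 + 2 * κ * ε k ^ 2 := by
  obtain ⟨h1, h2⟩ := D.mem_dualFeasible_iff.1 hω.1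
  rw [h2] at h1
  have h3 := dualValue_le h1 (h.Y_mem k) (h.Z_mem k)
  have h4 := dualValue_le_of_mem_dualOptimal hne hω hV
  have hσ := h.sigma_pos k
  -- Subtracting the Lagrangian bounds at `ω.fst` and at `W (k + 1)` leaves `⟪ω.fst - W (k + 1), Y -
  -- Z⟫ ≤ κ ε_k² / σ_k`. Multiplying by `σ k` turns `Y - Z` into the multiplier step and cancels the
  -- denominator.
  have h5 : inner ℝ (ω.fst - W (k + 1)) (W k - W (k + 1)) ≤ κ * ε k ^ 2 := by
    have e₁ : inner ℝ (ω.fst - W (k + 1)) (σ k • (Y (k + 1) - Z (k + 1))) =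
        σ k * inner ℝ (ω.fst - W (k + 1)) (Y (k + 1) - Z (k + 1)) :=
      real_inner_smul_right (ω.fst - W (k + 1)) (Y (k + 1) - Z (k + 1)) (σ k)
    rw [h.sub_eq k, e₁, inner_sub_left]
    have e : κ * ε k ^ 2 = σ k * (κ * (ε k ^ 2 / σ k)) := by field_simp
    rw [e]
    exact mul_le_mul_of_nonneg_left (by linarith) hσ.le
  have h6 := norm_sub_sq_add_le h5
  rw [norm_sub_rev (ω.fst), norm_sub_rev ω.fst] at h6
  linarith

/-- Convergence of the augmented Lagrangian method. -/
theorem IsALMSequence.convergence (hopt : ∃ Y Z, D.IsOptimal Y Z)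
    (hlip : D.LipschitzConjugate)
    (hrcq : D.DualRobinson)
    (herr : D.DualErrorBound)
    {σ ε : ℕ → ℝ} {Y Z W : ℕ → Sym (n + 1)}
    (hseq : D.IsALMSequence σ ε Y Z W) :
    (∃ ω ∈ D.dualOptimal, Tendsto W atTop (𝓝 ω.fst)) ∧
    Bornology.IsBounded (Set.range fun k => (Y k, Z k)) ∧
    ∀ Y' Z' : Sym (n + 1),
      MapClusterPt (Y', Z') atTop (fun k => (Y k, Z k)) → D.IsOptimal Y' Z' := by
  obtain ⟨Y₀, Z₀, hfeas₀, -⟩ := hopt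
  have hne : D.K.Nonempty := ⟨pair Y₀ Z₀, pair_mem_K hfeas₀.1 hfeas₀.2.1⟩
  obtain ⟨ω, hω, hR⟩ := hrcq
  obtain ⟨hωdom, hωs⟩ := D.mem_dualFeasible_iff.1 hω.1
  rw [hωs] at hωdom
  obtain ⟨κ, hκ, V, hV⟩ := hseq.exists_dualFeasible ⟨ω, hω.1⟩ hlip herr
  have hη : Tendsto (fun k => κ * (ε k ^ 2 / σ k)) atTop (𝓝 0) := by
    simpa using hseq.tendsto_tolerance.const_mul κ
  have hsum : Summable fun k => 2 * κ * ε k ^ 2 := hseq.summable_sq.mul_left _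
  have hsum0 : ∀ k, 0 ≤ 2 * κ * ε k ^ 2 := fun k => by positivity
  have hfejer := fun (θ : SymTriple (n + 1)) (hθ : θ ∈ D.dualOptimal) (k : ℕ) =>
    hseq.fejer hne hθ (hV k).1 (hV k).2.2
  have hconv : ∀ θ ∈ D.dualOptimal, ∃ l, Tendsto (fun k => ‖W k - θ.fst‖ ^ 2) atTop (𝓝 l) :=
    fun θ hθ => exists_tendsto_of_le_add_summable (fun k => sq_nonneg _) hsum0 hsum fun k => by
      linarith [hfejer θ hθ k, sq_nonneg ‖W k - W (k + 1)‖]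
  -- the primal residual tends to zero
  have hstep : Tendsto (fun k => ‖W k - W (k + 1)‖ ^ 2) atTop (𝓝 0) :=
    tendsto_zero_of_add_le (a := fun k => ‖W k - ω.fst‖ ^ 2) (fun k => sq_nonneg _) hsum0
      (fun k => sq_nonneg _) hsum fun k => hfejer ω hω k
  have hres : Tendsto (fun k => Y (k + 1) - Z (k + 1)) atTop (𝓝 0) := by
    rw [tendsto_zero_iff_norm_tendsto_zero]
    have h1 : Tendsto (fun k => ‖W k - W (k + 1)‖ / σ 0) atTop (𝓝 0) := by
      have := (hstep.sqrt).div_const (σ 0)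
      simpa [Real.sqrt_sq] using this
    refine squeeze_zero (fun k => norm_nonneg _) (fun k => ?_) h1
    rw [le_div_iff₀ (hseq.sigma_pos 0), hseq.sub_eq k, norm_smul,
      Real.norm_of_nonneg (hseq.sigma_pos k).le, mul_comm]
    exact mul_le_mul_of_nonneg_right (hseq.sigma_mono (Nat.zero_le k)) (norm_nonneg _)
  -- a cluster point of the multipliers
  have hWbdd : Bornology.IsBounded (Set.range W) := by
    obtain ⟨l, hl⟩ := hconv ω hω
    obtain ⟨b, hb⟩ := hl.bddAbove_range
    refine (Metric.isBounded_closedBall (x := ω.fst) (r := √b)).subset ?_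
    rintro _ ⟨k, rfl⟩
    rw [Metric.mem_closedBall, dist_eq_norm]
    exact Real.le_sqrt_of_sq_le (hb ⟨k, rfl⟩)
  -- The shifted sequence is used because `V k` is close to `W (k + 1)`.
  obtain ⟨W', -, φ, hφ, hWφ⟩ := tendsto_subseq_of_bounded (hWbdd.subset
    (Set.range_subset_iff.2 fun k => Set.mem_range_self (k + 1) :
      Set.range (fun k => W (k + 1)) ⊆ Set.range W)) (x := fun k => W (k + 1)) fun k => ⟨k, rfl⟩
  have hφt := hφ.tendsto_atTop
  have hVφ : Tendsto (fun k => V (φ k)) atTop (𝓝 W') := by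
    have h1 : Tendsto (fun k => V k - W (k + 1)) atTop (𝓝 0) :=
      squeeze_zero_norm (fun k => (hV k).2.1) hη
    have h2 := (h1.comp hφt).add hWφ
    rw [zero_add] at h2
    exact h2.congr fun k => sub_add_cancel _ _
  obtain ⟨bW, hbW⟩ := hWbdd.exists_norm_le
  have hbW' : ∀ k, ‖W k‖ ≤ bW := fun k => hbW _ ⟨k, rfl⟩
  have hWres : ∀ U : Sym (n + 1),
      Tendsto (fun k => inner ℝ (W (k + 1) - U) (Y (k + 1) - Z (k + 1))) atTop (𝓝 0) := by
    intro U
    have h1 : Tendsto (fun k => (bW + ‖U‖) * ‖Y (k + 1) - Z (k + 1)‖) atTop (𝓝 0) := by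
      simpa using hres.norm.const_mul (bW + ‖U‖)
    refine squeeze_zero_norm (fun k => (norm_inner_le_norm _ _).trans ?_) h1
    gcongr
    exact (norm_sub_le _ _).trans (by linarith [hbW' (k + 1)])
  -- the cluster point is dual optimal
  have hlim : ∀ U, D.slack U ∈ effDom D.pStar → ∀ Y₁ ∈ D.M, ∀ Z₁ ∈ D.P,
      D.dualValue U ≤ inner ℝ D.C Y₁ - inner ℝ W' (Y₁ - Z₁) := by
    intro U hU Y₁ hY₁ Z₁ hZ₁
    -- Each term bounds `θ(U)`: compare `U` with `W (k + 1)` in the Lagrangian at the iterate, pass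
    -- to `θ(V k)`, then apply weak duality at `(Y₁, Z₁)`. The limit is taken in the Lagrangian,
    -- which is continuous in `W`, so no continuity of `θ` is needed.
    have h1 : Tendsto (fun k => inner ℝ D.C Y₁ - inner ℝ (V (φ k)) (Y₁ - Z₁) +
        κ * (ε (φ k) ^ 2 / σ (φ k)) +
        inner ℝ (W (φ k + 1) - U) (Y (φ k + 1) - Z (φ k + 1))) atTop
        (𝓝 (inner ℝ D.C Y₁ - inner ℝ W' (Y₁ - Z₁) + 0 + 0)) :=
      ((tendsto_const_nhds.sub (hVφ.inner tendsto_const_nhds)).add (hη.comp hφt)).add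
        ((hWres U).comp hφt)
    rw [add_zero, add_zero] at h1
    refine ge_of_tendsto' h1 fun k => ?_
    have h2 := dualValue_le hU (hseq.Y_mem (φ k)) (hseq.Z_mem (φ k))
    have h3 := (hV (φ k)).2.2
    have h4 := dualValue_le (hV (φ k)).1 hY₁ hZ₁
    rw [inner_sub_left]
    linarith
  have hW'dom : D.slack W' ∈ effDom D.pStar :=
    (slack_mem_and_le_dualValue hne (hlim ω.fst hωdom)).1
  have hW'opt : triple W' (D.slack W') ∈ D.dualOptimal :=
    triple_mem_dualOptimal hne hW'dom fun U hU => (slack_mem_and_le_dualValue hne (hlim U hU)).2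
  -- the objective values
  have hobj : ∀ k, inner ℝ D.C (Y (k + 1)) ≤ D.dualValue ω.fst + κ * (ε k ^ 2 / σ k) +
      inner ℝ (W (k + 1) - 0) (Y (k + 1) - Z (k + 1)) := by
    intro k
    have h1 := dualValue_le_of_mem_dualOptimal hne hω (hV k).1
    rw [sub_zero]
    linarith [(hV k).2.2]
  have hobjlim : Tendsto (fun k => D.dualValue ω.fst + κ * (ε k ^ 2 / σ k) +
      inner ℝ (W (k + 1) - 0) (Y (k + 1) - Z (k + 1))) atTop (𝓝 (D.dualValue ω.fst)) := by
    simpa only [add_zero] using (tendsto_const_nhds.add hη).add (hWres 0)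
  refine ⟨⟨_, hW'opt, ?_⟩, ?_, ?_⟩
  · change Tendsto W atTop (𝓝 W')
    -- The squared distances to `W'` converge along the whole sequence, and a subsequence of them
    -- tends to zero.
    obtain ⟨l, hl⟩ := hconv _ hW'opt
    change Tendsto (fun k => ‖W k - W'‖ ^ 2) atTop (𝓝 l) at hl
    have h1 : Tendsto (fun k => ‖W (φ k + 1) - W'‖ ^ 2) atTop (𝓝 0) := by
      simpa using (tendsto_iff_norm_sub_tendsto_zero.1 hWφ).pow 2
    have h2 := hl.comp ((tendsto_add_atTop_nat 1).comp hφt)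
    rw [tendsto_nhds_unique h2 h1] at hl
    rw [tendsto_iff_norm_sub_tendsto_zero]
    simpa [Real.sqrt_sq] using hl.sqrt
  · obtain ⟨b, hb⟩ := hres.norm.bddAbove_range
    obtain ⟨c, hc⟩ := hobjlim.bddAbove_range
    have h1 := RobinsonCQ.isBounded_range hR hseq.Y_mem hseq.Z_mem
      (fun k => hb ⟨k, rfl⟩) (fun k => (hobj k).trans (hc ⟨k, rfl⟩))
    obtain ⟨r, hr⟩ := h1.exists_norm_le
    -- The estimates start at index `1`, so the arbitrary pair `(Y 0, Z 0)` is added by hand. The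
    -- norm of `Sym (n + 1) × Sym (n + 1)` is the maximum norm, dominated by that of `pair`.
    refine ((Metric.isBounded_closedBall (x := (0 : Sym (n + 1) × Sym (n + 1))) (r := r)).insert
      (Y 0, Z 0)).subset ?_
    rintro _ ⟨k, rfl⟩
    rcases k with _ | k
    · exact Set.mem_insert _ _
    · refine Set.mem_insert_of_mem _ ?_
      rw [mem_closedBall_zero_iff, Prod.norm_def]
      have h2 := hr _ ⟨k, rfl⟩
      exact max_le ((WithLp.norm_fst_le _ (pair (Y (k + 1)) (Z (k + 1)))).trans h2)
        ((WithLp.norm_snd_le _ (pair (Y (k + 1)) (Z (k + 1)))).trans h2)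
  · intro Y' Z' hcl
    obtain ⟨ψ, hψ, hlimψ⟩ := hcl.tendsto_subseq
    have hψt := hψ.tendsto_atTop
    -- Membership in `𝓜` and `P` holds from index `1` on; dropping the first term of the subsequence
    -- makes all its indices positive.
    have hY' : Tendsto (fun k => Y (ψ (k + 1))) atTop (𝓝 Y') :=
      ((continuous_fst.tendsto _).comp hlimψ).comp (tendsto_add_atTop_nat 1)
    have hZ' : Tendsto (fun k => Z (ψ (k + 1))) atTop (𝓝 Z') :=
      ((continuous_snd.tendsto _).comp hlimψ).comp (tendsto_add_atTop_nat 1)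
    -- positive indices are successors
    obtain ⟨m, hm⟩ : ∃ m : ℕ → ℕ, ∀ k, ψ (k + 1) = m k + 1 :=
      ⟨fun k => ψ (k + 1) - 1, fun k =>
        (Nat.sub_add_cancel (le_trans (Nat.le_add_left 1 k) hψ.le_apply)).symm⟩
    simp only [hm] at hY' hZ'
    have hmt : Tendsto m atTop atTop := by
      refine tendsto_atTop_mono (fun k => ?_) tendsto_id
      have := hψ.le_apply (x := k + 1)
      rw [hm k] at this
      exact Nat.le_of_succ_le_succ this
    have hM : Y' ∈ D.M := D.isClosed_M.mem_of_tendsto hY' (Eventually.of_forall fun k =>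
      hseq.Y_mem (m k))
    have hP : Z' ∈ D.P := D.polyhedral.isClosed.mem_of_tendsto hZ' (Eventually.of_forall fun k =>
      hseq.Z_mem (m k))
    refine ⟨⟨hM, hP, tendsto_nhds_unique (hY'.sub hZ') (hres.comp hmt)⟩, fun Y₁ Z₁ hf => ?_⟩
    -- The objective bounds tend to `θ` at the dual solution, which by weak duality is at most the
    -- objective of any feasible pair.
    have h1 : inner ℝ D.C Y' ≤ D.dualValue ω.fst :=
      le_of_tendsto_of_tendsto' (tendsto_const_nhds.inner hY') (hobjlim.comp hmt)
        fun k => hobj (m k)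
    have h2 := dualValue_le hωdom hf.1 hf.2.1
    rw [hf.2.2, inner_zero_right, sub_zero] at h2
    exact h1.trans h2

end Problem

end DNNALM

theorem mainTheorem9 {n q : ℕ} (D : DNNALM.Problem n q)
    (hopt : ∃ Y Z, D.IsOptimal Y Z)
    (hlip : D.LipschitzConjugate)
    (hrcq : D.DualRobinson)
    (herr : D.DualErrorBound)
    (σ ε : ℕ → ℝ) (Y Z W : ℕ → DNNALM.Sym (n + 1))
    (hseq : D.IsALMSequence σ ε Y Z W) :
    (∃ ω ∈ D.dualOptimal, Filter.Tendsto W Filter.atTop (nhds ω.fst)) ∧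
    Bornology.IsBounded (Set.range fun k => (Y k, Z k)) ∧
    ∀ Y' Z' : DNNALM.Sym (n + 1),
      MapClusterPt (Y', Z') Filter.atTop (fun k => (Y k, Z k)) → D.IsOptimal Y' Z' := by
  exact hseq.convergence hopt hlip hrcq herr
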